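/- Let $k:\mathbb{Z}\to\mathbb{R}$ be a positive definite symmetric function, i.e. $k(-t)=k(t)$ for all $t$ and $\sum_{s,t\in S}x_s\,k(t-s)\,x_t\ge 0$ for every finite $S\subset\mathbb{Z}$ and all real $(x_s)_{s\in S}$. Assume that $$\sum_{t\in\mathbb{Z}}|k(t)|=M<+\infty ,$$ and denote by $f(\lambda)=\sum_{t\in\mathbb{Z}}\mathrm{e}^{\mathrm{i}\lambda t}k(t)$ the corresponding (real-valued) spectral density. Let $Z=(Z_t)_{t\in\mathbb{Z}}$ be a centered stationary Gaussian process with covariance function $k$, i.e. $\mathbb{E}[Z_t]=0$ and $\mathbb{E}[Z_sZ_t]=k(t-s)$ for all $s,t\in\mathbb{Z}$, and let $m_\infty$ be a real number. Then for all $\alpha$ such that $0\le\alpha<1/(2M)$ (for all $\alpha\ge 0$ if $M=0$), $$\lim_{t\to+\infty}\frac1t\log\left(\mathbb{E}\left[\exp\left(-\alpha\sum_{s=0}^{t-1}(Z_s+m_\infty)^2\right)\right]\right)=-\ell_0(\alpha)-\ell_1(\alpha),$$ where $$\ell_0(\alpha)=\frac{1}{4\pi}\int_0^{2\pi}\log(1+2\alpha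 f(\lambda))\,\mathrm{d}\lambda \qquad\text{and}\qquad \ell_1(\alpha)=m_\infty^2\,\alpha\,(1+2\alpha f(0))^{-1}.$$ -/

import Mathlib

open MeasureTheory ProbabilityTheory Filter Topology

/-- A positive definite symmetric function on the integers, in the sense used for covariance
functions: `k (-t) = k t` and `∑ s, ∑ t, x s * k (t - s) * x t ≥ 0` for all finite families of
real coefficients. -/
def IsPositiveDefiniteSymmetric (k : ℤ → ℝ) : Prop :=
  (∀ t : ℤ, k (-t) = k t) ∧
    ∀ (S : Finset ℤ) (x : ℤ → ℝ), 0 ≤ ∑ s ∈ S, ∑ t ∈ S, x s * k (t - s) * x t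

/-- The spectral density `f(u) = ∑_{t ∈ ℤ} exp(i u t) k(t)`. -/
noncomputable def spectralDensity (k : ℤ → ℝ) (u : ℝ) : ℂ :=
  ∑' t : ℤ, Complex.exp (Complex.I * u * t) * (k t : ℂ)

/-- The spectral density of a symmetric function is real, so that taking its real part below
loses nothing. -/
theorem spectralDensity_eq_re {k : ℤ → ℝ} (hk : ∀ t : ℤ, k (-t) = k t) (u : ℝ) :
    spectralDensity k u = ((spectralDensity k u).re : ℂ) := by
  refine (Complex.conj_eq_iff_re.mp ?_).symm
  unfold spectralDensity
  rw [Complex.conj_tsum, ← (Equiv.neg ℤ).tsum_eq]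
  refine tsum_congr fun t => ?_
  simp [← Complex.exp_conj, hk]

/-- `ℓ₀(α) = (1 / 4π) ∫₀^{2π} log (1 + 2 α f(u)) du`. -/
noncomputable def ell0 (k : ℤ → ℝ) (α : ℝ) : ℝ :=
  1 / (4 * Real.pi) *
    ∫ u in (0 : ℝ)..(2 * Real.pi), Real.log (1 + 2 * α * (spectralDensity k u).re)

/-- `ℓ₁(α) = m∞² α (1 + 2 α f(0))⁻¹`. -/
noncomputable def ell1 (k : ℤ → ℝ) (mInf : ℝ) (α : ℝ) : ℝ :=
  mInf ^ 2 * α * (1 + 2 * α * (spectralDensity k 0).re)⁻¹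

/-! In an orthonormal eigenbasis of the Toeplitz covariance matrix of size `n`, the Gaussian vector
has independent coordinates whose variances are the eigenvalues `l i`. The log-expectation is
therefore an exact sum over `i` (`log_integral_exp_neg_sum_sq`), and two Szegő-type limits remain.
Both come from one fact: the exponential of frequency `u`, cut to `[0, n)`, has squared norm `n` and
is an eigenvector for the value `f(u)` up to a squared error `o(n)`, uniformly in `u`. Its spectral
weights `w i` thus sum to `n` and concentrate near `f(u)`, so `∑ w i * g (l i) = n * g (f u) + o(n)`
for Lipschitz `g` (`abs_sum_spectralWeight_mul_sub_le`). Taking `u = 0` and `g x = (1 + 2αx)⁻¹`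
gives `ℓ₁`. Averaging over `u`, which gives every eigenvector weight one, with `g x = log (1 + 2αx)`
gives `ℓ₀` (`abs_sum_eigenvalue_sub_integral_le`). -/

/-- The Gaussian integral `E exp (-α (Y + c)²)` for a centered Gaussian `Y` of variance `v`. -/
theorem integral_exp_neg_mul_add_sq_gaussianReal (v : NNReal) {α : ℝ} (hα : 0 ≤ α) (c : ℝ) :
    ∫ x, Real.exp (-α * (x + c) ^ 2) ∂(gaussianReal 0 v) =
      (√(1 + 2 * α * v))⁻¹ * Real.exp (-α * c ^ 2 / (1 + 2 * α * v)) := by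
  rcases eq_or_ne v 0 with rfl | hv
  · simp
  · have hv' : (0 : ℝ) < v := by positivity
    rw [integral_gaussianReal_eq_integral_smul hv]
    -- Completing the square: `b = α + 1 / (2v)` is the coefficient of `-x²` in the total exponent.
    set b : ℝ := (1 + 2 * α * v) / (2 * v) with hb
    have hb0 : 0 < b := by positivity
    have h1 : ∀ x : ℝ, gaussianPDFReal 0 v x • Real.exp (-α * (x + c) ^ 2) =
        ((√(2 * Real.pi * v))⁻¹ * Real.exp (-α * c ^ 2 / (1 + 2 * α * v))) *
          Real.exp (-b * (x + α * c / b) ^ 2) := by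
      intro x
      rw [gaussianPDFReal, smul_eq_mul, mul_assoc (√(2 * Real.pi * v))⁻¹,
        mul_assoc (√(2 * Real.pi * v))⁻¹, ← Real.exp_add, ← Real.exp_add]
      congr 2
      rw [hb]
      have : 1 + 2 * α * v ≠ 0 := by positivity
      field_simp
      ring
    simp_rw [h1]
    rw [integral_const_mul, integral_add_right_eq_self (fun x : ℝ => Real.exp (-b * x ^ 2)),
      integral_gaussian, mul_right_comm]
    congr 1
    rw [← Real.sqrt_inv, ← Real.sqrt_inv, ← Real.sqrt_mul (by positivity)]
    congr 1
    rw [hb]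
    have : 1 + 2 * α * v ≠ 0 := by positivity
    field_simp

/-! ### Diagonalization of symmetric matrices -/

/-- Coordinate form of the spectral theorem for a real symmetric matrix: an orthonormal family of
eigenvectors `U i` that satisfies Parseval's identity. -/
structure IsEigenbasis {n : ℕ} (K : Fin n → Fin n → ℝ) (U : Fin n → Fin n → ℝ)
    (l : Fin n → ℝ) : Prop where
  parseval : ∀ x : Fin n → ℝ, ∑ i, (∑ s, U i s * x s) ^ 2 = ∑ s, x s ^ 2
  eigen : ∀ i s, ∑ t, K s t * U i t = l i * U i s
  orthonormal : ∀ i j, ∑ s, U i s * U j s = if i = j then 1 else 0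

theorem exists_isEigenbasis {n : ℕ} (K : Fin n → Fin n → ℝ) (hK : ∀ s t, K s t = K t s) :
    ∃ U l, IsEigenbasis K U l := by
  have hA : (Matrix.of K).IsHermitian := by
    ext s t
    simp [hK s t]
  have hinner : ∀ x y : EuclideanSpace ℝ (Fin n), inner ℝ x y = ∑ s, x s * y s := by
    intro x y
    simp [PiLp.inner_apply, mul_comm]
  refine ⟨fun i s => hA.eigenvectorBasis i s, hA.eigenvalues, ⟨fun x => ?_, fun i s => ?_,
    fun i j => ?_⟩⟩
  · have := hA.eigenvectorBasis.sum_sq_norm_inner_right (WithLp.toLp 2 x)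
    simp only [hinner, EuclideanSpace.norm_sq_eq, Real.norm_eq_abs, sq_abs] at this
    exact this
  · have := congrFun (hA.mulVec_eigenvectorBasis i) s
    simpa [Matrix.mulVec, dotProduct] using this
  · rw [← hinner]
    exact orthonormal_iff_ite.mp hA.eigenvectorBasis.orthonormal i j

namespace IsEigenbasis

variable {n : ℕ} {K U : Fin n → Fin n → ℝ} {l : Fin n → ℝ}

theorem sum_mul_sum_eq (h : IsEigenbasis K U l) (hK : ∀ s t, K s t = K t s) (i : Fin n)
    (x : Fin n → ℝ) : ∑ s, U i s * ∑ t, K s t * x t = l i * ∑ t, U i t * x t := by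
  simp_rw [Finset.mul_sum]
  rw [Finset.sum_comm]
  refine Finset.sum_congr rfl fun t _ => ?_
  rw [← mul_assoc, ← h.eigen, Finset.sum_mul]
  exact Finset.sum_congr rfl fun s _ => by rw [hK t s]; ring

/-- Parseval for `(K - c) x`. It turns an approximate eigenvector into concentration of its spectral
weights near `c`. -/
theorem sum_sq_mul_sub_sq (h : IsEigenbasis K U l) (hK : ∀ s t, K s t = K t s) (c : ℝ)
    (x : Fin n → ℝ) :
    ∑ i, (∑ s, U i s * x s) ^ 2 * (l i - c) ^ 2 = ∑ s, (∑ t, K s t * x t - c * x s) ^ 2 := by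
  rw [← h.parseval]
  refine Finset.sum_congr rfl fun i _ => ?_
  have : ∑ s, U i s * (∑ t, K s t * x t - c * x s) = (l i - c) * ∑ s, U i s * x s := by
    simp_rw [mul_sub, Finset.sum_sub_distrib]
    rw [h.sum_mul_sum_eq hK, sub_mul, Finset.mul_sum _ _ c]
    congr 1
    exact Finset.sum_congr rfl fun s _ => by ring
  rw [this]
  ring

end IsEigenbasis

/-! ### Gaussian vectors in eigencoordinates -/

section Gaussian

variable {Ω : Type*} [MeasurableSpace Ω] {P : Measure Ω} {n : ℕ}
  {X : Fin n → Ω → ℝ} {K U : Fin n → Fin n → ℝ} {l : Fin n → ℝ}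

theorem hasGaussianLaw_eigenCoordinates (hX : HasGaussianLaw (fun ω i => X i ω) P)
    (U : Fin n → Fin n → ℝ) : HasGaussianLaw (fun ω i => ∑ s, U i s * X s ω) P := by
  have := hX.map_fun
    (LinearMap.toContinuousLinearMap (Matrix.mulVecLin (Matrix.of U)))
  refine this.congr (ae_of_all _ fun ω => ?_)
  ext i
  simp [Matrix.mulVec, dotProduct]

variable [IsProbabilityMeasure P]

theorem covariance_eigenCoordinates (hX : HasGaussianLaw (fun ω i => X i ω) P)
    (hmean : ∀ i, ∫ ω, X i ω ∂P = 0) (hcov : ∀ s t, ∫ ω, X s ω * X t ω ∂P = K s t)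
    (h : IsEigenbasis K U l) (i j : Fin n) :
    cov[fun ω => ∑ s, U i s * X s ω, fun ω => ∑ s, U j s * X s ω; P] =
      if i = j then l i else 0 := by
  have hL : ∀ i, MemLp (X i) 2 P := fun i => (hX.eval i).memLp_two
  rw [covariance_fun_sum_fun_sum (fun s => (hL s).const_mul _) (fun s => (hL s).const_mul _)]
  have hc : ∀ s t, cov[fun ω => U i s * X s ω, fun ω => U j t * X t ω; P] =
      U i s * (U j t * K s t) := by
    intro s t
    rw [covariance_const_mul_left, covariance_const_mul_right, covariance_eq_sub (hL s) (hL t),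
      hmean, hmean, ← hcov]
    simp
  simp_rw [hc, ← Finset.mul_sum]
  have hK : ∀ s, ∑ t, U j t * K s t = l j * U j s := fun s => by
    rw [← h.eigen]
    exact Finset.sum_congr rfl fun t _ => mul_comm _ _
  simp_rw [hK]
  have : ∑ s, U i s * (l j * U j s) = l j * ∑ s, U i s * U j s := by
    rw [Finset.mul_sum]
    exact Finset.sum_congr rfl fun s _ => by ring
  rw [this, h.orthonormal]
  split_ifs with hij <;> simp [hij]

theorem IsEigenbasis.eigenvalue_nonneg_of_covariance (h : IsEigenbasis K U l)
    (hX : HasGaussianLaw (fun ω i => X i ω) P)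
    (hmean : ∀ i, ∫ ω, X i ω ∂P = 0) (hcov : ∀ s t, ∫ ω, X s ω * X t ω ∂P = K s t) (i : Fin n) :
    0 ≤ l i := by
  have hv := covariance_eigenCoordinates hX hmean hcov h i i
  rw [covariance_self ((hasGaussianLaw_eigenCoordinates hX U).eval i).aemeasurable, if_pos rfl]
    at hv
  rw [← hv]
  exact variance_nonneg _ _

/-- The eigencoordinates are uncorrelated and jointly Gaussian, hence independent, and Parseval
keeps the sum of squares diagonal. The expectation factors into one-dimensional Gaussian integrals.
-/
theorem log_integral_exp_neg_sum_sq (hX : HasGaussianLaw (fun ω i => X i ω) P)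
    (hmean : ∀ i, ∫ ω, X i ω ∂P = 0) (hcov : ∀ s t, ∫ ω, X s ω * X t ω ∂P = K s t)
    (h : IsEigenbasis K U l) {α : ℝ} (hα : 0 ≤ α) (m : ℝ) :
    Real.log (∫ ω, Real.exp (-α * ∑ s, (X s ω + m) ^ 2) ∂P) =
      ∑ i, (-(1 / 2) * Real.log (1 + 2 * α * l i) -
        m ^ 2 * α * ((∑ s, U i s) ^ 2 * (1 + 2 * α * l i)⁻¹)) := by
  set Y : Fin n → Ω → ℝ := fun i ω => ∑ s, U i s * X s ω with hY
  have hYG : HasGaussianLaw (fun ω i => Y i ω) P := hasGaussianLaw_eigenCoordinates hX U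
  have hcovY := covariance_eigenCoordinates hX hmean hcov h
  have hl := h.eigenvalue_nonneg_of_covariance hX hmean hcov
  have hYm : ∀ i, AEMeasurable (Y i) P := fun i => (hYG.eval i).aemeasurable
  have hind : iIndepFun Y P := hYG.iIndepFun_of_covariance_eq_zero fun i j hij => by
    rw [hY, hcovY, if_neg hij]
  have hlaw : ∀ i, P.map (Y i) = gaussianReal 0 (l i).toNNReal := by
    intro i
    rw [(hYG.eval i).map_eq_gaussianReal, ← covariance_self (hYm i), hcovY, if_pos rfl]
    have h0 : ∫ ω, Y i ω ∂P = 0 := by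
      rw [integral_finsetSum]
      · simp [integral_const_mul, hmean]
      · exact fun s _ => ((hX.eval s).integrable).const_mul _
    rw [h0]
  -- The coordinates of the constant vector `m` in the eigenbasis.
  set c : Fin n → ℝ := fun i => m * ∑ s, U i s with hc
  have hsum : ∀ ω, Real.exp (-α * ∑ s, (X s ω + m) ^ 2) =
      ∏ i, Real.exp (-α * (Y i ω + c i) ^ 2) := by
    intro ω
    rw [← Real.exp_sum, ← Finset.mul_sum, ← h.parseval]
    congr 2
    refine Finset.sum_congr rfl fun i _ => ?_
    simp only [hY, hc, mul_add, Finset.sum_add_distrib, ← Finset.sum_mul]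
    ring
  simp_rw [hsum]
  have hmeas : ∀ i, Measurable fun x : ℝ => Real.exp (-α * (x + c i) ^ 2) := fun i => by fun_prop
  rw [hind.integral_fun_prod_comp hYm fun i => (hmeas i).aestronglyMeasurable]
  have hi : ∀ i, ∫ ω, Real.exp (-α * (Y i ω + c i) ^ 2) ∂P =
      (√(1 + 2 * α * l i))⁻¹ * Real.exp (-α * c i ^ 2 / (1 + 2 * α * l i)) := by
    intro i
    rw [← integral_map (hYm i) (hmeas i).aestronglyMeasurable, hlaw,
      integral_exp_neg_mul_add_sq_gaussianReal _ hα, Real.coe_toNNReal _ (hl i)]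
  simp_rw [hi]
  have hpos : ∀ i, 0 < 1 + 2 * α * l i := fun i => by
    have := mul_nonneg hα (hl i)
    nlinarith
  rw [Real.log_prod fun i _ => by have := hpos i; positivity]
  refine Finset.sum_congr rfl fun i _ => ?_
  have := hpos i
  rw [Real.log_mul (by positivity) (by positivity), Real.log_exp, Real.log_inv,
    Real.log_sqrt (hpos i).le]
  simp only [hc]
  field_simp
  ring

end Gaussian

/-! ### Truncation error of the Toeplitz matrix -/

theorem abs_tsum_sub_sum_le {ι : Type*} {f g : ι → ℝ} (hg : Summable g)
    (hfg : ∀ i, |f i| ≤ g i) (S : Finset ι) :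
    |∑' i, f i - ∑ i ∈ S, f i| ≤ ∑' i, g i - ∑ i ∈ S, g i := by
  have hf : Summable f := Summable.of_norm_bounded hg hfg
  rw [← hf.sum_add_tsum_compl (s := S), ← hg.sum_add_tsum_compl (s := S), add_sub_cancel_left,
    add_sub_cancel_left]
  rw [← Real.norm_eq_abs]
  exact tsum_of_norm_bounded (hg.subtype _).hasSum fun i => hfg i.1

/-- The total weight of `|k (t - s)|` over `0 ≤ s < n` and `t ∉ [0, n)`. -/
noncomputable def boundaryWeight (k : ℤ → ℝ) (n : ℕ) : ℝ :=
  ∑ s : Fin n, (∑' t, |k t| - ∑ t : Fin n, |k ((t : ℤ) - (s : ℤ))|)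

theorem sum_fin_eq_sum_Ico (n : ℕ) (h : ℤ → ℝ) :
    ∑ t : Fin n, h (t : ℤ) = ∑ t ∈ Finset.Ico (0 : ℤ) n, h t := by
  rw [Fin.sum_univ_eq_sum_range (fun t : ℕ => h t)]
  refine Finset.sum_bij' (fun t _ => (t : ℤ)) (fun t _ => t.toNat) ?_ ?_ ?_ ?_ ?_ <;>
    simp <;> omega

theorem tsum_sub_sum_fin_eq {k : ℤ → ℝ} (hk : Summable fun t => |k t|) (n : ℕ) (s : ℤ) :
    ∑' t, |k t| - ∑ t : Fin n, |k ((t : ℤ) - s)| =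
      ∑' t, if t + s ∈ Finset.Ico (0 : ℤ) n then 0 else |k t| := by
  have h1 : ∑ t : Fin n, |k ((t : ℤ) - s)| =
      ∑' t, if t + s ∈ Finset.Ico (0 : ℤ) n then |k t| else 0 := by
    rw [sum_fin_eq_sum_Ico n fun t => |k (t - s)|, ← (Equiv.addRight (-s)).tsum_eq,
      tsum_eq_sum (s := Finset.Ico (0 : ℤ) n)]
    · refine Finset.sum_congr rfl fun t ht => ?_
      simp only [Equiv.coe_addRight, neg_add_cancel_right, if_pos ht, sub_eq_add_neg]
    · intro t ht
      simp only [Equiv.coe_addRight, neg_add_cancel_right, if_neg ht]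
  have hs : Summable fun t => if t + s ∈ Finset.Ico (0 : ℤ) n then |k t| else 0 :=
    hk.of_nonneg_of_le (fun t => by split_ifs <;> positivity)
      fun t => by split_ifs; exacts [le_rfl, abs_nonneg _]
  rw [h1, ← hk.tsum_sub hs]
  refine tsum_congr fun t => ?_
  split_ifs <;> simp

/-- Exchanging the sums groups the weight by lag `t`: `|k t|` counts once for each `s` that the
shift by `t` moves out of `[0, n)`. -/
theorem boundaryWeight_eq {k : ℤ → ℝ} (hk : Summable fun t => |k t|) (n : ℕ) :
    boundaryWeight k n =
      ∑' t, ((Finset.range n).filter fun s : ℕ => t + s ∉ Finset.Ico (0 : ℤ) n).card * |k t| := by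
  have hs : ∀ s : ℕ, Summable fun t : ℤ => if t + s ∈ Finset.Ico (0 : ℤ) n then 0 else |k t| :=
    fun s => hk.of_nonneg_of_le (fun t => by split_ifs <;> positivity)
      fun t => by split_ifs; exacts [abs_nonneg _, le_rfl]
  rw [boundaryWeight, Finset.sum_congr rfl fun s _ => tsum_sub_sum_fin_eq hk n _,
    Fin.sum_univ_eq_sum_range
      (fun s : ℕ => ∑' t : ℤ, if t + (s : ℤ) ∈ Finset.Ico (0 : ℤ) n then 0 else |k t|),
    ← Summable.tsum_finsetSum fun s _ => hs s]
  refine tsum_congr fun t => ?_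
  rw [Finset.card_filter, Nat.cast_sum, Finset.sum_mul]
  refine Finset.sum_congr rfl fun s _ => ?_
  split_ifs <;> simp_all

theorem card_filter_add_notMem_Ico_le (n : ℕ) (t : ℤ) :
    ((Finset.range n).filter fun s : ℕ => t + s ∉ Finset.Ico (0 : ℤ) n).card ≤ t.natAbs := by
  rcases le_total 0 t with ht | ht
  · refine (Finset.card_le_card (t := Finset.Ico (n - t.natAbs) n) fun s => ?_).trans
      (by rw [Nat.card_Ico]; omega)
    simp
    omega
  · refine (Finset.card_le_card (t := Finset.range t.natAbs) fun s => ?_).trans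
      (Finset.card_range _).le
    simp
    omega

/-- After division by `n`, the coefficient of `|k t|` is at most `1` and at most `|t| / n`, so
dominated convergence applies with summability of `|k|` alone. -/
theorem tendsto_boundaryWeight_div {k : ℤ → ℝ} (hk : Summable fun t => |k t|) :
    Tendsto (fun n : ℕ => boundaryWeight k n / n) atTop (𝓝 0) := by
  have key : Tendsto (fun n : ℕ => ∑' t : ℤ,
      (((Finset.range n).filter fun s : ℕ => t + s ∉ Finset.Ico (0 : ℤ) n).card / n : ℝ) * |k t|)
      atTop (𝓝 (∑' _ : ℤ, (0 : ℝ))) := by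
    refine tendsto_tsum_of_dominated_convergence hk (fun t => ?_) (Eventually.of_forall fun n t => ?_)
    · have h0 : Tendsto (fun n : ℕ => (t.natAbs : ℝ) / n) atTop (𝓝 0) :=
        tendsto_const_div_atTop_nhds_zero_nat _
      have h1 : Tendsto (fun n : ℕ =>
          (((Finset.range n).filter fun s : ℕ => t + s ∉ Finset.Ico (0 : ℤ) n).card / n : ℝ))
          atTop (𝓝 0) := by
        refine squeeze_zero (fun n => by positivity) (fun n => ?_) h0
        gcongr
        exact card_filter_add_notMem_Ico_le n t
      simpa using h1.mul_const |k t|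
    · rw [norm_mul, Real.norm_eq_abs, Real.norm_eq_abs, abs_abs, abs_of_nonneg (by positivity)]
      refine mul_le_of_le_one_left (abs_nonneg _) (div_le_one_of_le₀ ?_ (Nat.cast_nonneg _))
      exact_mod_cast (Finset.card_filter_le _ _).trans (Finset.card_range n).le
  rw [tsum_zero] at key
  refine key.congr fun n => ?_
  rw [boundaryWeight_eq hk, ← tsum_div_const]
  exact tsum_congr fun t => by ring

/-! ### Exponentials as eigenfunctions of convolution with `k` -/

theorem spectralDensity_re {k : ℤ → ℝ} (hk : Summable fun t => |k t|) (u : ℝ) :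
    (spectralDensity k u).re = ∑' t : ℤ, k t * Real.cos (u * t) := by
  have hn : ∀ t : ℤ, Complex.exp (Complex.I * u * t) = Complex.exp ((u * t : ℝ) * Complex.I) := by
    intro t
    push_cast
    ring_nf
  have hs : Summable fun t : ℤ => Complex.exp (Complex.I * u * t) * (k t : ℂ) := by
    refine Summable.of_norm_bounded hk fun t => ?_
    rw [norm_mul, hn, Complex.norm_exp_ofReal_mul_I]
    simp
  rw [spectralDensity, Complex.re_tsum hs]
  refine tsum_congr fun t => ?_
  rw [hn, Complex.re_mul_ofReal, Complex.exp_ofReal_mul_I_re, mul_comm]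

theorem summable_mul_of_abs_le_one {k x : ℤ → ℝ} (hk : Summable fun t => |k t|)
    (hx : ∀ t, |x t| ≤ 1) : Summable fun t => k t * x t :=
  Summable.of_norm_bounded hk fun t => by
    rw [norm_mul]
    exact mul_le_of_le_one_right (abs_nonneg _) (hx t)

theorem continuous_spectralDensity_re {k : ℤ → ℝ} (hk : Summable fun t => |k t|) :
    Continuous fun u => (spectralDensity k u).re := by
  simp_rw [spectralDensity_re hk]
  refine continuous_tsum (fun t => by fun_prop) hk fun t u => ?_
  rw [norm_mul]
  exact mul_le_of_le_one_right (abs_nonneg _) (Real.abs_cos_le_one _)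

theorem tsum_mul_sin_eq_zero {k : ℤ → ℝ} (hsymm : ∀ t, k (-t) = k t) (u : ℝ) :
    ∑' t : ℤ, k t * Real.sin (u * t) = 0 := by
  have h : ∑' t : ℤ, k t * Real.sin (u * t) = -∑' t : ℤ, k t * Real.sin (u * t) := by
    conv_lhs => rw [← (Equiv.neg ℤ).tsum_eq]
    rw [← tsum_neg]
    exact tsum_congr fun t => by simp [hsymm]
  linarith

/-- Shift by `s` and expand the cosine of the sum; the sine series vanishes because `k` is even. -/
theorem tsum_mul_cos_eq {k : ℤ → ℝ} (hk : Summable fun t => |k t|) (hsymm : ∀ t, k (-t) = k t)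
    (u : ℝ) (s : ℤ) :
    ∑' t : ℤ, k (t - s) * Real.cos (u * t) = (spectralDensity k u).re * Real.cos (u * s) := by
  rw [← (Equiv.addRight s).tsum_eq, spectralDensity_re hk, ← tsum_mul_right]
  have h2 := summable_mul_of_abs_le_one hk (x := fun t => Real.sin (u * t))
    fun t => Real.abs_sin_le_one _
  have h1 := summable_mul_of_abs_le_one hk (x := fun t => Real.cos (u * t))
    fun t => Real.abs_cos_le_one _
  rw [← sub_zero (∑' t : ℤ, k t * Real.cos (u * t) * Real.cos (u * s)),
    ← zero_mul (Real.sin (u * s)), ← tsum_mul_sin_eq_zero hsymm u, ← tsum_mul_right,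
    ← (h1.mul_right _).tsum_sub (h2.mul_right _)]
  refine tsum_congr fun t => ?_
  simp only [Equiv.coe_addRight, add_sub_cancel_right, Int.cast_add, mul_add, Real.cos_add]
  ring

theorem tsum_mul_sin_eq {k : ℤ → ℝ} (hk : Summable fun t => |k t|) (hsymm : ∀ t, k (-t) = k t)
    (u : ℝ) (s : ℤ) :
    ∑' t : ℤ, k (t - s) * Real.sin (u * t) = (spectralDensity k u).re * Real.sin (u * s) := by
  rw [← (Equiv.addRight s).tsum_eq, spectralDensity_re hk, ← tsum_mul_right]
  have h2 := summable_mul_of_abs_le_one hk (x := fun t => Real.sin (u * t))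
    fun t => Real.abs_sin_le_one _
  have h1 := summable_mul_of_abs_le_one hk (x := fun t => Real.cos (u * t))
    fun t => Real.abs_cos_le_one _
  rw [← zero_add (∑' t : ℤ, k t * Real.cos (u * t) * Real.sin (u * s)),
    ← zero_mul (Real.cos (u * s)), ← tsum_mul_sin_eq_zero hsymm u, ← tsum_mul_right,
    ← (h2.mul_right _).tsum_add (h1.mul_right _)]
  refine tsum_congr fun t => ?_
  simp only [Equiv.coe_addRight, add_sub_cancel_right, Int.cast_add, mul_add, Real.sin_add]
  ring

/-- A bounded eigenfunction of convolution with `k` is an approximate eigenvector of the Toeplitz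
matrix of `k`. -/
theorem sum_sq_toeplitz_sub_le {k x : ℤ → ℝ} {c : ℝ} (hk : Summable fun t => |k t|)
    (hx : ∀ t, |x t| ≤ 1) (hc : ∀ s, ∑' t, k (t - s) * x t = c * x s) (n : ℕ) :
    ∑ s : Fin n, (∑ t : Fin n, k ((t : ℤ) - (s : ℤ)) * x t - c * x s) ^ 2 ≤
      (∑' t, |k t|) * boundaryWeight k n := by
  rw [boundaryWeight, Finset.mul_sum]
  refine Finset.sum_le_sum fun s _ => ?_
  have hks : Summable fun t => |k (t - s)| := (Equiv.subRight (s : ℤ)).summable_iff.mpr hk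
  have hM : ∑' t, |k (t - s)| = ∑' t, |k t| :=
    (Equiv.subRight (s : ℤ)).tsum_eq fun t => |k t|
  have h := abs_tsum_sub_sum_le (f := fun t => k (t - s) * x t) hks
    (fun t => by
      rw [abs_mul]
      exact mul_le_of_le_one_right (abs_nonneg _) (hx t)) (Finset.Ico 0 n)
  rw [hc, hM, ← sum_fin_eq_sum_Ico n fun t => k (t - s) * x t,
    ← sum_fin_eq_sum_Ico n fun t => |k (t - s)|, abs_sub_comm] at h
  -- One factor of the square is bounded by the full sum of `|k|`. The other keeps the tail, so that
  -- summing over `s` produces `boundaryWeight` to the first power.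
  have h2 : ∑' t, |k t| - ∑ t : Fin n, |k ((t : ℤ) - (s : ℤ))| ≤ ∑' t, |k t| :=
    sub_le_self _ (Finset.sum_nonneg fun _ _ => abs_nonneg _)
  rw [← sq_abs, sq]
  exact mul_le_mul (h.trans h2) h (abs_nonneg _) (tsum_nonneg fun _ => abs_nonneg _)

/-! ### Spectral weights of exponentials -/

/-- The weight at the `i`-th eigenvector of the spectral measure of the exponential of
frequency `u`. -/
noncomputable def spectralWeight {n : ℕ} (U : Fin n → Fin n → ℝ) (u : ℝ) (i : Fin n) : ℝ :=
  (∑ s : Fin n, U i s * Real.cos (u * ((s : ℤ) : ℝ))) ^ 2 +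
    (∑ s : Fin n, U i s * Real.sin (u * ((s : ℤ) : ℝ))) ^ 2

theorem spectralWeight_nonneg {n : ℕ} (U : Fin n → Fin n → ℝ) (u : ℝ) (i : Fin n) :
    0 ≤ spectralWeight U u i := by
  unfold spectralWeight
  positivity

theorem spectralWeight_zero {n : ℕ} (U : Fin n → Fin n → ℝ) (i : Fin n) :
    spectralWeight U 0 i = (∑ s, U i s) ^ 2 := by
  simp [spectralWeight]

theorem continuous_spectralWeight {n : ℕ} (U : Fin n → Fin n → ℝ) (i : Fin n) :
    Continuous fun u => spectralWeight U u i := by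
  unfold spectralWeight
  fun_prop

theorem integral_cos_mul_int (j : ℤ) :
    ∫ u in (0 : ℝ)..(2 * Real.pi), Real.cos (u * j) = if j = 0 then 2 * Real.pi else 0 := by
  split_ifs with h
  · simp [h]
  · have hj : (j : ℝ) ≠ 0 := by exact_mod_cast h
    rw [intervalIntegral.integral_comp_mul_right (fun u => Real.cos u) hj, integral_cos]
    have := Real.sin_int_mul_two_pi_sub 0 j
    rw [show 2 * Real.pi * (j : ℝ) = j * (2 * Real.pi) - 0 by ring, this]
    simp

theorem spectralWeight_eq {n : ℕ} (U : Fin n → Fin n → ℝ) (u : ℝ) (i : Fin n) :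
    spectralWeight U u i =
      ∑ s : Fin n, ∑ t : Fin n, U i s * U i t * Real.cos (u * (((s : ℤ) - (t : ℤ) : ℤ) : ℝ)) := by
  rw [spectralWeight, sq, sq, Finset.sum_mul_sum, Finset.sum_mul_sum, ← Finset.sum_add_distrib]
  refine Finset.sum_congr rfl fun s _ => ?_
  rw [← Finset.sum_add_distrib]
  refine Finset.sum_congr rfl fun t _ => ?_
  rw [Int.cast_sub, mul_sub, Real.cos_sub]
  ring

namespace IsEigenbasis

variable {n : ℕ} {K U : Fin n → Fin n → ℝ} {l : Fin n → ℝ}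

/-- Integration over a period kills the frequencies `s - t ≠ 0`, leaving the squared norm of `U i`.
-/
theorem integral_spectralWeight (h : IsEigenbasis K U l) (i : Fin n) :
    ∫ u in (0 : ℝ)..(2 * Real.pi), spectralWeight U u i = 2 * Real.pi := by
  simp_rw [spectralWeight_eq]
  rw [intervalIntegral.integral_finsetSum
    fun s _ => Continuous.intervalIntegrable (by fun_prop) _ _]
  have : ∀ s : Fin n, ∫ u in (0 : ℝ)..(2 * Real.pi),
      ∑ t : Fin n, U i s * U i t * Real.cos (u * (((s : ℤ) - (t : ℤ) : ℤ) : ℝ)) =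
        U i s * U i s * (2 * Real.pi) := by
    intro s
    rw [intervalIntegral.integral_finsetSum
      fun s _ => Continuous.intervalIntegrable (by fun_prop) _ _, Finset.sum_eq_single s]
    · rw [intervalIntegral.integral_const_mul, integral_cos_mul_int]
      simp
    · intro t _ hts
      rw [intervalIntegral.integral_const_mul, integral_cos_mul_int, if_neg, mul_zero]
      intro h0
      exact hts (Fin.ext (by omega))
    · simp
  simp_rw [this]
  rw [← Finset.sum_mul, h.orthonormal, if_pos rfl, one_mul]

theorem sum_spectralWeight (h : IsEigenbasis K U l) (u : ℝ) :
    ∑ i, spectralWeight U u i = n := by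
  simp only [spectralWeight, Finset.sum_add_distrib]
  rw [h.parseval fun s => Real.cos (u * ((s : ℤ) : ℝ)),
    h.parseval fun s => Real.sin (u * ((s : ℤ) : ℝ)), ← Finset.sum_add_distrib]
  simp

end IsEigenbasis

/-! ### Szegő-type limits for Toeplitz eigenvalues -/

section Toeplitz

variable {k : ℤ → ℝ} {n : ℕ} {U : Fin n → Fin n → ℝ} {l : Fin n → ℝ}

/-- The spectral measure of the Toeplitz matrix of `k` at the exponential of frequency `u`
concentrates at the value of the spectral density at `u`. -/
theorem sum_spectralWeight_mul_sub_sq_le (hk : Summable fun t => |k t|)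
    (hsymm : ∀ t, k (-t) = k t)
    (h : IsEigenbasis (fun s t : Fin n => k ((t : ℤ) - (s : ℤ))) U l) (u : ℝ) :
    ∑ i, spectralWeight U u i * (l i - (spectralDensity k u).re) ^ 2 ≤
      2 * (∑' t, |k t|) * boundaryWeight k n := by
  have hK : ∀ s t : Fin n, k ((t : ℤ) - (s : ℤ)) = k ((s : ℤ) - (t : ℤ)) := fun s t => by
    rw [← hsymm, neg_sub]
  simp only [spectralWeight, add_mul, Finset.sum_add_distrib]
  rw [h.sum_sq_mul_sub_sq hK _ fun s => Real.cos (u * ((s : ℤ) : ℝ)),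
    h.sum_sq_mul_sub_sq hK _ fun s => Real.sin (u * ((s : ℤ) : ℝ))]
  have h1 := sum_sq_toeplitz_sub_le hk (fun t => Real.abs_cos_le_one (u * t))
    (fun s => tsum_mul_cos_eq hk hsymm u s) n
  have h2 := sum_sq_toeplitz_sub_le hk (fun t => Real.abs_sin_le_one (u * t))
    (fun s => tsum_mul_sin_eq hk hsymm u s) n
  linarith

/-- The weights sum to `n`, so the difference is a weighted sum of `g (l i) - g (f u)`. The
Lipschitz bound and Cauchy–Schwarz reduce it to the second moment already estimated. -/
theorem abs_sum_spectralWeight_mul_sub_le (hk : Summable fun t => |k t|)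
    (hsymm : ∀ t, k (-t) = k t)
    (h : IsEigenbasis (fun s t : Fin n => k ((t : ℤ) - (s : ℤ))) U l) (hl : ∀ i, 0 ≤ l i) {u : ℝ}
    (hu : 0 ≤ (spectralDensity k u).re) {g : ℝ → ℝ} {L : ℝ} (hL : 0 ≤ L)
    (hg : ∀ x y, 0 ≤ x → 0 ≤ y → |g x - g y| ≤ L * |x - y|) :
    |∑ i, spectralWeight U u i * g (l i) - n * g (spectralDensity k u).re| ≤
      L * √(n * (2 * (∑' t, |k t|) * boundaryWeight k n)) := by
  set f := (spectralDensity k u).re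
  have hw := spectralWeight_nonneg U u
  rw [← h.sum_spectralWeight u, Finset.sum_mul, ← Finset.sum_sub_distrib]
  calc |∑ i, (spectralWeight U u i * g (l i) - spectralWeight U u i * g f)|
      ≤ ∑ i, |spectralWeight U u i * g (l i) - spectralWeight U u i * g f| :=
        Finset.abs_sum_le_sum_abs _ _
    _ ≤ ∑ i, L * (√(spectralWeight U u i) * √(spectralWeight U u i * (l i - f) ^ 2)) := by
        refine Finset.sum_le_sum fun i _ => ?_
        rw [← mul_sub, abs_mul, abs_of_nonneg (hw i), Real.sqrt_mul (hw i), Real.sqrt_sq_eq_abs,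
          ← mul_assoc (√_), Real.mul_self_sqrt (hw i), mul_left_comm]
        exact mul_le_mul_of_nonneg_left (hg _ _ (hl i) hu) (hw i)
    _ ≤ L * (√(∑ i, spectralWeight U u i) *
          √(∑ i, spectralWeight U u i * (l i - f) ^ 2)) := by
        rw [← Finset.mul_sum]
        exact mul_le_mul_of_nonneg_left (Real.sum_sqrt_mul_sqrt_le _ hw
          fun i => mul_nonneg (hw i) (sq_nonneg _)) hL
    _ ≤ L * √((∑ i, spectralWeight U u i) * (2 * (∑' t, |k t|) * boundaryWeight k n)) := by
        rw [Real.sqrt_mul (Finset.sum_nonneg fun i _ => hw i)]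
        gcongr
        exact sum_spectralWeight_mul_sub_sq_le hk hsymm h u

/-- The bound for a single frequency does not depend on `u`, so it survives averaging over a period;
each weight averages to one. -/
theorem abs_sum_eigenvalue_sub_integral_le (hk : Summable fun t => |k t|)
    (hsymm : ∀ t, k (-t) = k t)
    (h : IsEigenbasis (fun s t : Fin n => k ((t : ℤ) - (s : ℤ))) U l) (hl : ∀ i, 0 ≤ l i)
    (hf : ∀ u, 0 ≤ (spectralDensity k u).re) {g : ℝ → ℝ} {L : ℝ} (hL : 0 ≤ L)
    (hg : ∀ x y, 0 ≤ x → 0 ≤ y → |g x - g y| ≤ L * |x - y|) :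
    |∑ i, g (l i) -
        n * (1 / (2 * Real.pi) * ∫ u in (0 : ℝ)..(2 * Real.pi), g (spectralDensity k u).re)| ≤
      L * √(n * (2 * (∑' t, |k t|) * boundaryWeight k n)) := by
  have hpi := Real.pi_pos
  have hgc : ContinuousOn g (Set.Ici 0) := by
    have : LipschitzOnWith L.toNNReal g (Set.Ici 0) :=
      LipschitzOnWith.of_dist_le_mul fun x hx y hy => by
        rw [Real.dist_eq, Real.dist_eq, Real.coe_toNNReal _ hL]
        exact hg x y hx hy
    exact this.continuousOn
  have hgf : Continuous fun u => g (spectralDensity k u).re :=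
    hgc.comp_continuous (continuous_spectralDensity_re hk) hf
  have hw : ∀ i, Continuous fun u => spectralWeight U u i * g (l i) := fun i =>
    (continuous_spectralWeight U i).mul continuous_const
  have hgn : Continuous fun u => n * g (spectralDensity k u).re := continuous_const.mul hgf
  have hsum : ∫ u in (0 : ℝ)..(2 * Real.pi), ∑ i, spectralWeight U u i * g (l i) =
      2 * Real.pi * ∑ i, g (l i) := by
    rw [intervalIntegral.integral_finsetSum
      fun i _ => (hw i).intervalIntegrable _ _, Finset.mul_sum]
    refine Finset.sum_congr rfl fun i _ => ?_
    rw [intervalIntegral.integral_mul_const, h.integral_spectralWeight]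
  have hint : ∫ u in (0 : ℝ)..(2 * Real.pi),
      (∑ i, spectralWeight U u i * g (l i) - n * g (spectralDensity k u).re) =
        2 * Real.pi * (∑ i, g (l i) -
        n * (1 / (2 * Real.pi) * ∫ u in (0 : ℝ)..(2 * Real.pi), g (spectralDensity k u).re)) := by
    rw [intervalIntegral.integral_sub
      ((continuous_finsetSum _ fun i _ => hw i).intervalIntegrable _ _)
      (hgn.intervalIntegrable _ _), hsum,
      intervalIntegral.integral_const_mul]
    field_simp
  have hb := intervalIntegral.norm_integral_le_of_norm_le_const (a := 0) (b := 2 * Real.pi)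
    (f := fun u => ∑ i, spectralWeight U u i * g (l i) - n * g (spectralDensity k u).re)
    fun u _ => abs_sum_spectralWeight_mul_sub_le hk hsymm h hl (hf u) hL hg
  rw [hint, norm_mul, Real.norm_eq_abs, Real.norm_eq_abs, sub_zero,
    abs_of_pos (by positivity : 0 < 2 * Real.pi), mul_comm] at hb
  exact le_of_mul_le_mul_right hb (by positivity)

theorem tendsto_sqrt_boundaryWeight_div (hk : Summable fun t => |k t|) (C L : ℝ) :
    Tendsto (fun n : ℕ => L * √(n * (C * boundaryWeight k n)) / n) atTop (𝓝 0) := by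
  have h := (((tendsto_boundaryWeight_div hk).const_mul C).sqrt).const_mul L
  simp only [mul_zero, Real.sqrt_zero] at h
  refine h.congr fun n => ?_
  rcases Nat.eq_zero_or_pos n with rfl | hn
  · simp
  · have hn' : (0 : ℝ) < n := by exact_mod_cast hn
    rw [show (n : ℝ) * (C * boundaryWeight k n) = n ^ 2 * (C * (boundaryWeight k n / n)) by
      field_simp, Real.sqrt_mul (sq_nonneg (n : ℝ)), Real.sqrt_sq hn'.le]
    field_simp

/-- If `f(u) < 0`, every `l i ≥ 0` is at distance at least `|f(u)|` from `f(u)`, so the mean squared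
distance, which tends to zero, would be at least `f(u)²`. -/
theorem spectralDensity_re_nonneg (hk : Summable fun t => |k t|) (hsymm : ∀ t, k (-t) = k t)
    (hbasis : ∀ n, ∃ U l, IsEigenbasis (fun s t : Fin n => k ((t : ℤ) - (s : ℤ))) U l ∧
      ∀ i, 0 ≤ l i) (u : ℝ) :
    0 ≤ (spectralDensity k u).re := by
  by_contra! hneg
  have hlim := (tendsto_boundaryWeight_div hk).const_mul (2 * ∑' t, |k t|)
  rw [mul_zero] at hlim
  have hle : (spectralDensity k u).re ^ 2 ≤ 0 := by
    refine ge_of_tendsto hlim ?_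
    filter_upwards [eventually_gt_atTop 0] with n hn
    have hn' : (0 : ℝ) < n := by exact_mod_cast hn
    obtain ⟨U, l, h, hl⟩ := hbasis n
    rw [← mul_div_assoc, le_div_iff₀ hn']
    refine le_trans ?_ (sum_spectralWeight_mul_sub_sq_le hk hsymm h u)
    rw [← h.sum_spectralWeight u, mul_comm, Finset.sum_mul]
    refine Finset.sum_le_sum fun i _ =>
      mul_le_mul_of_nonneg_left ?_ (spectralWeight_nonneg U u i)
    nlinarith [hl i]
  nlinarith

end Toeplitz

/-! ### Lipschitz bounds on the half-line and the conclusion -/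

theorem abs_log_one_add_mul_sub_le {a : ℝ} (ha : 0 ≤ a) {x y : ℝ} (hx : 0 ≤ x) (hy : 0 ≤ y) :
    |Real.log (1 + a * x) - Real.log (1 + a * y)| ≤ a * |x - y| := by
  wlog hxy : y ≤ x generalizing x y
  · rw [abs_sub_comm, abs_sub_comm x]
    exact this hy hx (le_of_not_ge hxy)
  have h1 : 0 < 1 + a * y := by positivity
  have h2 : 0 < 1 + a * x := by positivity
  have h3 : 1 + a * y ≤ 1 + a * x := by gcongr
  rw [abs_of_nonneg (sub_nonneg.2 (Real.log_le_log h1 h3)), abs_of_nonneg (sub_nonneg.2 hxy),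
    ← Real.log_div h2.ne' h1.ne']
  -- `log r ≤ r - 1` for the ratio `r` of the two arguments, whose denominator is at least `1`.
  refine (Real.log_le_sub_one_of_pos (by positivity)).trans ?_
  rw [div_sub_one h1.ne', div_le_iff₀ h1]
  have : 0 ≤ a * (x - y) := mul_nonneg ha (sub_nonneg.2 hxy)
  nlinarith [mul_nonneg this (mul_nonneg ha hy)]

theorem abs_inv_one_add_mul_sub_le {a : ℝ} (ha : 0 ≤ a) {x y : ℝ} (hx : 0 ≤ x) (hy : 0 ≤ y) :
    |(1 + a * x)⁻¹ - (1 + a * y)⁻¹| ≤ a * |x - y| := by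
  have h1 : 1 ≤ 1 + a * y := by nlinarith [mul_nonneg ha hy]
  have h2 : 1 ≤ 1 + a * x := by nlinarith [mul_nonneg ha hx]
  have h3 : 0 < 1 + a * y := by linarith
  have h4 : 0 < 1 + a * x := by linarith
  rw [inv_sub_inv h4.ne' h3.ne', abs_div, abs_of_pos (mul_pos h4 h3),
    show 1 + a * y - (1 + a * x) = a * (y - x) by ring, abs_mul, abs_of_nonneg ha,
    abs_sub_comm y]
  exact div_le_self (by positivity) (one_le_mul_of_one_le_of_one_le h2 h1)

theorem proposition2 {Ω : Type*} [MeasurableSpace Ω] (P : Measure Ω) [IsProbabilityMeasure P]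
    (k : ℤ → ℝ) (hk : IsPositiveDefiniteSymmetric k)
    (M : ℝ) (hM : HasSum (fun t : ℤ => |k t|) M)
    (Z : ℤ → Ω → ℝ) (hZ : IsGaussianProcess Z P)
    (hmean : ∀ t : ℤ, ∫ ω, Z t ω ∂P = 0)
    (hcov : ∀ s t : ℤ, ∫ ω, Z s ω * Z t ω ∂P = k (t - s))
    (mInf : ℝ) (α : ℝ) (hα : 0 ≤ α) (hαM : 2 * α * M < 1) :
    Tendsto
      (fun t : ℕ => 1 / (t : ℝ) *
        Real.log (∫ ω, Real.exp (-α * ∑ s ∈ Finset.range t, (Z (s : ℤ) ω + mInf) ^ 2) ∂P))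
      atTop (𝓝 (-ell0 k α - ell1 k mInf α)) := by
  have hS : Summable fun t => |k t| := hM.summable
  have hsymm := hk.1
  have hX : ∀ n : ℕ, HasGaussianLaw (fun ω (i : Fin n) => Z (i : ℤ) ω) P := fun n => by
    let S : Finset ℤ := Finset.univ.image fun i : Fin n => (i : ℤ)
    have hmem : ∀ i : Fin n, (i : ℤ) ∈ S := fun i => Finset.mem_image_of_mem _ (Finset.mem_univ i)
    exact (hZ.hasGaussianLaw S).map_fun
      (ContinuousLinearMap.pi fun i : Fin n =>
        (ContinuousLinearMap.proj (⟨(i : ℤ), hmem i⟩ : S) : (S → ℝ) →L[ℝ] ℝ))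
  have hbasis : ∀ n : ℕ, ∃ U l, IsEigenbasis (fun s t : Fin n => k ((t : ℤ) - (s : ℤ))) U l ∧
      ∀ i, 0 ≤ l i := fun n => by
    obtain ⟨U, l, h⟩ := exists_isEigenbasis (fun s t : Fin n => k ((t : ℤ) - (s : ℤ)))
      fun s t => by rw [← hsymm, neg_sub]
    exact ⟨U, l, h, h.eigenvalue_nonneg_of_covariance (hX n) (fun i => hmean i)
      fun s t => hcov s t⟩
  have hf := spectralDensity_re_nonneg hS hsymm hbasis
  choose U l h hl using hbasis
  have ha : 0 ≤ 2 * α := by positivity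
  set f0 := (spectralDensity k 0).re with hf0
  -- Since `boundaryWeight k n = o(n)`, the common error bound is `o(n)`; this serves both limits.
  have hsqueeze : ∀ {a : ℕ → ℝ} {b L : ℝ},
      (∀ n, |a n - n * b| ≤ L * √(n * (2 * (∑' t, |k t|) * boundaryWeight k n))) →
      Tendsto (fun n : ℕ => a n / n) atTop (𝓝 b) := by
    intro a b L hab
    rw [tendsto_iff_dist_tendsto_zero]
    refine squeeze_zero' (Eventually.of_forall fun _ => dist_nonneg) ?_
      (tendsto_sqrt_boundaryWeight_div hS (2 * ∑' t, |k t|) L)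
    filter_upwards [eventually_gt_atTop 0] with n hn
    have hn' : (0 : ℝ) < n := by exact_mod_cast hn
    rw [Real.dist_eq, div_sub' hn'.ne', abs_div, abs_of_pos hn']
    gcongr
    exact hab n
  have hlog := hsqueeze fun n => abs_sum_eigenvalue_sub_integral_le hS hsymm (h n) (hl n) hf ha
    fun x y hx hy => abs_log_one_add_mul_sub_le ha hx hy
  have hinv := hsqueeze fun n => abs_sum_spectralWeight_mul_sub_le hS hsymm (h n) (hl n) (hf 0) ha
    fun x y hx hy => abs_inv_one_add_mul_sub_le ha hx hy
  have hlim := (hlog.const_mul (-(1 / 2))).sub (hinv.const_mul (mInf ^ 2 * α))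
  have hval : -(1 / 2) * (1 / (2 * Real.pi) * ∫ u in (0 : ℝ)..(2 * Real.pi),
      Real.log (1 + 2 * α * (spectralDensity k u).re)) - mInf ^ 2 * α * (1 + 2 * α * f0)⁻¹ =
        -ell0 k α - ell1 k mInf α := by
    rw [ell0, ell1]
    ring
  rw [hval] at hlim
  refine hlim.congr fun n => ?_
  simp_rw [← Fin.sum_univ_eq_sum_range fun s : ℕ => (Z (s : ℤ) _ + mInf) ^ 2]
  rw [log_integral_exp_neg_sum_sq (hX n) (fun i => hmean i) (fun s t => hcov s t) (h n) hα,
    Finset.sum_sub_distrib, ← Finset.mul_sum, ← Finset.mul_sum]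
  simp_rw [spectralWeight_zero]
  ring
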